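/- Let $|\psi\rangle\in\mathbb C^N$ be a unit vector, $\rho=|\psi\rangle\langle\psi|$ its matrix in the standard (reference) basis, $C_{\ell_1}(\psi)=\sum_{i\ne j}|\rho_{ij}|$, and $C_r(\psi)=\min_\delta S(\rho\|\delta)$, where $\delta$ runs over the density matrices that are diagonal in the reference basis and $S(\rho\|\delta)=\operatorname{tr}[\rho(\log_2\rho-\log_2\delta)]$ (equal to $+\infty$ unless $\operatorname{supp}\rho\subseteq\operatorname{supp}\delta$). Write $H_2(x)=-x\log_2x-(1-x)\log_2(1-x)$ and use the convention that $0\cdot\log_2 0=0$. Suppose $C_{\ell_1}(\psi)=b$. Let $d=\operatorname{rank}[\operatorname{diag}(\rho)]$, let $n=b+1$ if $b$ is an integer and $n=\lfloor b\rfloor+2$ otherwise, and put $$\alpha=\frac{2+(d-2)(d-b)+2\sqrt{(b+1)(d-1)(d-1-b)}}{d^2},\qquad \beta=\frac{2+(n-2)(n-b)-2\sqrt{(b+1)(n-1)(n-1-b)}}{n^2}.$$ Then $$H_2(\alpha)+(1-\alpha)\log_2(d-1)\ \le\ C_r(\psi)\ \le\ H_2(\beta)+(1-\beta)\log_2(n-1).$$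 The lower bound is an equality if and only if, up to a permutation, the diagonal of $\rho$ is $\bigl(\alpha,\tfrac{1-\alpha}{d-1},\dots,\tfrac{1-\alpha}{d-1},0,\dots,0\bigr)$ with $d-1$ entries $\tfrac{1-\alpha}{d-1}$; the upper bound is an equality if and only if, up to a permutation, it is $\bigl(\beta,\tfrac{1-\beta}{n-1},\dots,\tfrac{1-\beta}{n-1},0,\dots,0\bigr)$ with $n-1$ entries $\tfrac{1-\beta}{n-1}$. Both bounds are attained: for every integer $d$ with $1\le d\le N$ and every real $b$ with $0<b\le d-1$ (or $d=1$, $b=0$) there is a unit vector in $\mathbb C^N$ with $C_{\ell_1}=b$ and diagonal rank $d$ for which the lower bound is an equality; and for every real $b$ with $0\le b\le N-1$ there is a unit vector in $\mathbb C^N$ with $C_{\ell_1}=b$ for which the upper bound is an equality. -/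

import Mathlib

open scoped ComplexOrder

noncomputable section

namespace Coherence

/-- The (unnormalised) projector `|ψ⟩⟨ψ|`, as a matrix in the fixed reference basis;
it is the density matrix of a pure state when `‖ψ‖ = 1`. -/
def pureState {N : ℕ} (ψ : EuclideanSpace ℂ (Fin N)) : Matrix (Fin N) (Fin N) ℂ :=
  Matrix.of fun i j => ψ i * star (ψ j)

/-- The `ℓ₁`-norm of coherence: the sum of the absolute values of the off-diagonal entries. -/
def l1Coherence {N : ℕ} (ρ : Matrix (Fin N) (Fin N) ℂ) : ℝ :=
  ∑ i, ∑ j, if i ≠ j then ‖ρ i j‖ else 0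

/-- The incoherent states: density matrices that are diagonal in the reference basis. -/
def incoherentStates (N : ℕ) : Set (Matrix (Fin N) (Fin N) ℂ) :=
  {δ | δ.PosSemidef ∧ δ.trace = 1 ∧ δ.IsDiag}

open Classical in
/-- The quantum relative entropy `S(ρ‖δ) = tr[ρ (log₂ ρ - log₂ δ)]` of two states, with value `+∞`
unless the support of `ρ` lies in that of `δ`. The matrix logarithm is the continuous functional
calculus of `Real.logb 2`; since `Real.logb 2 0 = 0`, kernels contribute nothing, which is the
usual convention `0 log 0 = 0` when the support condition holds. -/
def relEntropy {N : ℕ} (ρ δ : Matrix (Fin N) (Fin N) ℂ) : EReal :=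
  if ∀ v : Fin N → ℂ, δ.mulVec v = 0 → ρ.mulVec v = 0 then
    (((ρ * (cfc (Real.logb 2) ρ - cfc (Real.logb 2) δ)).trace.re : ℝ) : EReal)
  else ⊤

/-- The relative entropy of coherence `C_r(ρ) = min_δ S(ρ‖δ)` over incoherent states `δ`. -/
def relEntropyCoherence {N : ℕ} (ρ : Matrix (Fin N) (Fin N) ℂ) : EReal :=
  ⨅ δ ∈ incoherentStates N, relEntropy ρ δ

/-- The rank of the diagonal part of `ρ`. -/
def diagRank {N : ℕ} (ρ : Matrix (Fin N) (Fin N) ℂ) : ℕ :=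
  (Matrix.diagonal ρ.diag).rank

/-- The binary entropy function in bits. -/
def H₂ (x : ℝ) : ℝ := -x * Real.logb 2 x - (1 - x) * Real.logb 2 (1 - x)

def alpha (b : ℝ) (d : ℕ) : ℝ :=
  (2 + ((d : ℝ) - 2) * ((d : ℝ) - b)
    + 2 * Real.sqrt ((b + 1) * ((d : ℝ) - 1) * ((d : ℝ) - 1 - b))) / (d : ℝ) ^ 2

def beta (b : ℝ) (n : ℕ) : ℝ :=
  (2 + ((n : ℝ) - 2) * ((n : ℝ) - b)
    - 2 * Real.sqrt ((b + 1) * ((n : ℝ) - 1) * ((n : ℝ) - 1 - b))) / (n : ℝ) ^ 2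

open Classical in
/-- For `b ≥ 0`: `b + 1` if `b` is an integer, and `[b] + 2` otherwise. -/
def supportSize (b : ℝ) : ℕ :=
  if ∃ m : ℕ, b = (m : ℝ) then ⌊b⌋₊ + 1 else ⌊b⌋₊ + 2

/-- `H₂(x) + (1 - x) log₂ (k - 1)`. For `k = 1` it is used only at `x = 1`, where the second
term is `0 * Real.logb 2 0 = 0`. -/
def entropyBound (x : ℝ) (k : ℕ) : ℝ :=
  H₂ x + (1 - x) * Real.logb 2 ((k : ℝ) - 1)

/-- The vector `(x, (1 - x)/(k - 1), …, (1 - x)/(k - 1), 0, …, 0)` of length `N`, whose first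
`k` entries are the displayed ones. -/
def profile (N k : ℕ) (x : ℝ) : Fin N → ℝ := fun i =>
  if (i : ℕ) = 0 then x else if (i : ℕ) < k then (1 - x) / ((k : ℝ) - 1) else 0

/-- Up to a permutation, the diagonal of `ρ` is the vector `p`. -/
def HasDiagonal {N : ℕ} (ρ : Matrix (Fin N) (Fin N) ℂ) (p : Fin N → ℝ) : Prop :=
  ∃ σ : Equiv.Perm (Fin N), ∀ i, ρ (σ i) (σ i) = (p i : ℂ)

end Coherence

end

noncomputable section
namespace Coherence
open Real Matrix

/-! By Gibbs' inequality the minimising incoherent state is the diagonal part of `ρ`, so `C_r` is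
the Shannon entropy of the numbers `x i ^ 2` with `x i = ‖ψ i‖`. The constraints become `∑ x i = s =
√(b + 1)` and `∑ x i ^ 2 = 1`. Hence any quadratic in `t`, summed over the support, has a value
fixed by `b` and the size of the support, and entropies can be compared through quadratic
interpolants of `f t = negMulLog (t ^ 2)`.

The sign of the interpolation error comes from `f' t = 4 negMulLog t - 2 t`, which is strictly
concave and stays so after subtracting a quadratic with nonnegative leading coefficient. By Rolle, a
cubic meeting `f` at four nonnegative points, counted with multiplicity, has negative leading
coefficient.

Lower bound (`entropyBound_le_sum_negMulLog`): Cauchy–Schwarz caps every amplitude at `A = √α`. The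
quadratic tangent to `f` at the common value `c` of the other amplitudes and meeting it at `A` lies
below `f` on `[0, A]`; summing gives the bound, and equality forces all amplitudes into `{c, A}`.

Upper bound (`sum_negMulLog_le_entropyBound`): a maximiser exists by compactness. If `0 < x ≤ y < z`
are three of its entries, `exists_triple_entropy_lt` raises the entropy, so all nonzero entries but
a smallest one are equal. The constraints then determine the number of nonzero entries and their
values. -/

/-! ### Relative entropy of coherence of a pure state as a Shannon entropy. -/

lemma cfc_diagonal {n : Type*} [Fintype n] [DecidableEq n] (f : ℝ → ℝ) (q : n → ℝ) :
    cfc f (diagonal fun i => (q i : ℂ)) = diagonal fun i => (f (q i) : ℂ) := by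
  classical
  have hsa : IsSelfAdjoint (diagonal fun i => (q i : ℂ)) := by
    rw [← Matrix.isHermitian_iff_isSelfAdjoint, isHermitian_diagonal_iff]
    intro i; simp [IsSelfAdjoint]
  -- The spectrum is the finite set of the `q i`, so `f` may be replaced by its Lagrange
  -- interpolant, whose calculus commutes with the algebra map `diagonal`.
  obtain ⟨P, hP⟩ : ∃ P : Polynomial ℝ, ∀ i, P.eval (q i) = f (q i) :=
    ⟨Lagrange.interpolate (Finset.univ.image q) id f, fun i =>
      Lagrange.eval_interpolate_at_node f (Function.injective_id.injOn)
        (Finset.mem_image_of_mem q (Finset.mem_univ i))⟩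
  have hdiag : (diagonal fun i => (q i : ℂ)) = diagonalAlgHom ℝ (fun i => (q i : ℂ)) := rfl
  have hspec : (spectrum ℝ (diagonal fun i => (q i : ℂ))).EqOn f P.eval := by
    intro r hr
    rw [hdiag] at hr
    have := AlgHom.spectrum_apply_subset _ _ hr
    rw [Pi.spectrum_eq] at this
    obtain ⟨i, hi⟩ := Set.mem_iUnion.1 this
    have hr' : r = q i := by
      have : ((q i : ℝ) : ℂ) = algebraMap ℝ ℂ (q i) := rfl
      rw [this, spectrum.scalar_eq] at hi
      exact hi
    rw [hr']
    exact (hP i).symm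
  rw [cfc_congr hspec, cfc_polynomial P _ hsa, hdiag, Polynomial.aeval_algHom_apply]
  refine congrArg diagonal (funext fun i => ?_)
  rw [← hP i]
  exact (Polynomial.aeval_algHom_apply (Pi.evalAlgHom ℝ (fun _ : n => ℂ) i) _ P).symm.trans
    (Polynomial.aeval_algebraMap_apply_eq_algebraMap_eval (A := ℂ) (q i) P)

lemma pureState_mul_self {N : ℕ} {ψ : EuclideanSpace ℂ (Fin N)} (h : ‖ψ‖ = 1) :
    pureState ψ * pureState ψ = pureState ψ := by
  have h1 : ∑ j, star (ψ j) * ψ j = 1 := by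
    have := EuclideanSpace.norm_sq_eq ψ
    rw [h] at this
    have h2 : ∀ j, star (ψ j) * ψ j = ((‖ψ j‖ ^ 2 : ℝ) : ℂ) := fun j => by
      simpa using Complex.conj_mul' (ψ j)
    simp_rw [h2, ← Complex.ofReal_sum, ← this]; simp
  ext i j
  simp only [pureState, mul_apply, of_apply]
  calc _ = ∑ k, ψ i * star (ψ j) * (star (ψ k) * ψ k) := by congr with k; ring
    _ = _ := by rw [← Finset.mul_sum, h1, mul_one]

/-- The projector is idempotent, so its spectrum lies in `{0, 1}`, and `Real.logb 2` vanishes at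
both points (at `0` by the default value). -/
lemma cfc_logb_pureState {N : ℕ} {ψ : EuclideanSpace ℂ (Fin N)} (h : ‖ψ‖ = 1) :
    cfc (Real.logb 2) (pureState ψ) = 0 := by
  have hspec : (spectrum ℝ (pureState ψ)).EqOn (Real.logb 2) (fun _ => 0) := by
    intro r hr
    have hr' := IsIdempotentElem.spectrum_subset ℝ (pureState_mul_self h) hr
    rcases hr' with rfl | hr'
    · simp
    · rw [Set.mem_singleton_iff.1 hr']; simp
  rw [cfc_congr hspec, cfc_const_zero]

lemma diag_pureState {N : ℕ} (ψ : EuclideanSpace ℂ (Fin N)) (i : Fin N) :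
    pureState ψ i i = ((‖ψ i‖ ^ 2 : ℝ) : ℂ) := by
  simpa [pureState] using Complex.mul_conj' (ψ i)

lemma sum_norm_sq_eq_one {N : ℕ} {ψ : EuclideanSpace ℂ (Fin N)} (h : ‖ψ‖ = 1) :
    ∑ i, ‖ψ i‖ ^ 2 = 1 := by
  rw [← EuclideanSpace.norm_sq_eq, h, one_pow]

lemma l1Coherence_pureState {N : ℕ} {ψ : EuclideanSpace ℂ (Fin N)} (h : ‖ψ‖ = 1) :
    l1Coherence (pureState ψ) = (∑ i, ‖ψ i‖) ^ 2 - 1 := by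
  have h1 : ∀ i, (∑ j, if i ≠ j then ‖pureState ψ i j‖ else 0)
      = ‖ψ i‖ * (∑ j, ‖ψ j‖) - ‖ψ i‖ ^ 2 := fun i => by
    have : ∀ j, (if i ≠ j then ‖pureState ψ i j‖ else 0)
        = ‖ψ i‖ * ‖ψ j‖ - if i = j then ‖ψ i‖ ^ 2 else 0 := fun j => by
      by_cases hij : i = j
      · subst hij; simp [sq]
      · simp [hij, pureState]
    simp_rw [this, Finset.sum_sub_distrib, Finset.mul_sum]
    simp
  simp_rw [l1Coherence, h1, Finset.sum_sub_distrib, sum_norm_sq_eq_one h, ← Finset.sum_mul, sq]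

lemma diagRank_pureState {N : ℕ} (ψ : EuclideanSpace ℂ (Fin N)) :
    diagRank (pureState ψ) = (Finset.univ.filter fun i => ‖ψ i‖ ≠ 0).card := by
  classical
  rw [diagRank, Matrix.rank_diagonal, Fintype.card_subtype]
  simp [diag_pureState]

lemma hasDiagonal_pureState_iff {N : ℕ} (ψ : EuclideanSpace ℂ (Fin N)) (p : Fin N → ℝ) :
    HasDiagonal (pureState ψ) p ↔ ∃ σ : Equiv.Perm (Fin N), ∀ i, ‖ψ (σ i)‖ ^ 2 = p i := by
  simp_rw [HasDiagonal, diag_pureState, Complex.ofReal_inj]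

/-- Gibbs' inequality. -/
lemma gibbs_inequality {n : Type*} [Fintype n] {p q : n → ℝ} (hp : ∀ i, 0 ≤ p i)
    (hq : ∀ i, 0 ≤ q i) (hsum : ∑ i, q i ≤ ∑ i, p i) (hpq : ∀ i, q i = 0 → p i = 0) :
    ∑ i, negMulLog (p i) ≤ ∑ i, -(p i * log (q i)) := by
  have h : ∀ i, negMulLog (p i) + p i * log (q i) ≤ q i - p i := fun i => by
    rcases (hp i).eq_or_lt with h0 | h0
    · simpa [← h0] using hq i
    · have hqi : 0 < q i := (hq i).lt_of_ne fun e => h0.ne' (hpq i e.symm)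
      have := log_le_sub_one_of_pos (div_pos hqi h0)
      rw [log_div hqi.ne' h0.ne'] at this
      have h2 := mul_le_mul_of_nonneg_left this h0.le
      have h3 : p i * (q i / p i - 1) = q i - p i := by field_simp
      rw [negMulLog]
      linarith
  have := Finset.sum_le_sum fun i (_ : i ∈ Finset.univ) => h i
  rw [Finset.sum_add_distrib, Finset.sum_sub_distrib] at this
  rw [Finset.sum_neg_distrib]
  linarith

lemma relEntropy_pureState_diagonal {N : ℕ} {ψ : EuclideanSpace ℂ (Fin N)} (h : ‖ψ‖ = 1)
    (q : Fin N → ℝ) :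
    ((pureState ψ * (cfc (Real.logb 2) (pureState ψ)
      - cfc (Real.logb 2) (diagonal fun i => (q i : ℂ)))).trace.re : ℝ)
      = (∑ i, -(‖ψ i‖ ^ 2 * log (q i))) / log 2 := by
  rw [cfc_logb_pureState h, cfc_diagonal, zero_sub, mul_neg, trace_neg, trace]
  simp only [diag_apply, mul_diagonal, diag_pureState, ← Complex.ofReal_mul,
    ← Complex.ofReal_sum, ← Complex.ofReal_neg, Complex.ofReal_re]
  rw [Finset.sum_neg_distrib, neg_div, Finset.sum_div]
  simp only [logb, mul_div_assoc]

/-- The relative entropy of coherence of a pure state is the Shannon entropy of its diagonal. -/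
theorem relEntropyCoherence_pureState {N : ℕ} {ψ : EuclideanSpace ℂ (Fin N)} (h : ‖ψ‖ = 1) :
    relEntropyCoherence (pureState ψ)
      = (((∑ i, negMulLog (‖ψ i‖ ^ 2)) / log 2 : ℝ) : EReal) := by
  have hlog : 0 < log 2 := log_pos one_lt_two
  apply le_antisymm
  · have hmem : (diagonal fun i => ((‖ψ i‖ ^ 2 : ℝ) : ℂ)) ∈ incoherentStates N := by
      refine ⟨posSemidef_diagonal_iff.2 fun i => ?_, ?_, isDiag_diagonal _⟩
      · exact_mod_cast sq_nonneg ‖ψ i‖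
      · rw [trace_diagonal, ← Complex.ofReal_sum, sum_norm_sq_eq_one h, Complex.ofReal_one]
    refine (iInf₂_le _ hmem).trans ?_
    rw [relEntropy, if_pos]
    · rw [relEntropy_pureState_diagonal h]
      simp [negMulLog]
    · intro v hv
      have hv' : ∀ j, star (ψ j) * v j = 0 := fun j => by
        have := congrFun hv j
        rw [mulVec_diagonal] at this
        rcases mul_eq_zero.1 this with h0 | h0
        · have : ψ j = 0 := by simpa using h0
          simp [this]
        · simp [h0]
      ext i
      simp [mulVec, dotProduct, pureState, mul_assoc] at hv' ⊢
      exact Finset.sum_eq_zero fun j _ => by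
        rcases hv' j with h0 | h0 <;> simp [h0]
  · refine le_iInf₂ fun δ hδ => ?_
    obtain ⟨hpos, htr, hdiag⟩ := hδ
    rw [relEntropy]
    split_ifs with hsupp
    · obtain ⟨q, rfl⟩ : ∃ q : Fin N → ℝ, δ = diagonal fun i => (q i : ℂ) := by
        refine ⟨fun i => (δ i i).re, ?_⟩
        conv_lhs => rw [← hdiag.diagonal_diag]
        congr 1
        ext i
        exact Complex.ext rfl (Complex.nonneg_iff.1 (hpos.diag_nonneg (i := i))).2.symm
      rw [relEntropy_pureState_diagonal h, EReal.coe_le_coe_iff]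
      refine div_le_div_of_nonneg_right (gibbs_inequality (fun i => sq_nonneg _) (fun i => ?_) ?_
        fun i hi => ?_) hlog.le
      · have := posSemidef_diagonal_iff.1 hpos i
        exact_mod_cast this
      · rw [sum_norm_sq_eq_one h]
        rw [trace_diagonal] at htr
        exact_mod_cast htr.le
      -- Applied to a basis vector, the support condition says that `q i = 0` forces `ψ i = 0`.
      · have h0 : (diagonal fun i => (q i : ℂ)) *ᵥ Pi.single i 1 = 0 := by
          ext j
          rw [mulVec_diagonal]
          by_cases hj : j = i
          · subst hj; simp [hi]
          · simp [hj]
        have := congrFun (hsupp _ h0) i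
        rw [mulVec_single_one] at this
        simpa [diag_pureState] using this
    · exact le_top

/-! ### Quadratic interpolation of `negMulLog (t ^ 2)`. -/

/-- The derivative of `t ↦ negMulLog (t ^ 2)` on the positive half-line. -/
def entropySlope (t : ℝ) : ℝ := 4 * negMulLog t - 2 * t

lemma hasDerivAt_negMulLog_sq {t : ℝ} (ht : 0 < t) :
    HasDerivAt (fun u => negMulLog (u ^ 2)) (entropySlope t) t := by
  have h := HasDerivAt.comp (h := fun u : ℝ => u ^ 2) t
    (hasDerivAt_negMulLog (pow_pos ht 2).ne') (hasDerivAt_pow 2 t)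
  refine h.congr_deriv ?_
  simp only [entropySlope, negMulLog, log_pow]
  push_cast
  ring

lemma strictConcaveOn_entropySlope_sub {c₁ c₂ c₃ : ℝ} (hc : 0 ≤ c₃) :
    StrictConcaveOn ℝ (Set.Ici 0)
      (fun t => entropySlope t - (c₁ + 2 * c₂ * t + 3 * c₃ * t ^ 2)) := by
  refine ⟨convex_Ici 0, fun x hx y hy hxy a b ha hb hab => ?_⟩
  have h := strictConcaveOn_negMulLog.2 hx hy hxy ha hb hab
  have hsq : 0 ≤ c₃ * (a * b * (x - y) ^ 2) := by positivity
  obtain rfl : b = 1 - a := by linarith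
  simp only [smul_eq_mul, entropySlope] at h ⊢
  nlinarith

lemma not_three_zeros_of_strictConcaveOn {S : Set ℝ} {g : ℝ → ℝ} (hg : StrictConcaveOn ℝ S g)
    {u v w : ℝ} (hu : u ∈ S) (hw : w ∈ S) (huv : u < v) (hvw : v < w)
    (gu : g u = 0) (gv : g v = 0) (gw : g w = 0) : False := by
  have h := hg.2 hu hw (huv.trans hvw).ne
    (div_pos (sub_pos.2 hvw) (sub_pos.2 (huv.trans hvw)))
    (div_pos (sub_pos.2 huv) (sub_pos.2 (huv.trans hvw)))
    (by have : w - u ≠ 0 := by linarith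
        field_simp; ring)
  have hv : (w - v) / (w - u) * u + (v - u) / (w - u) * w = v := by
    have : w - u ≠ 0 := by linarith
    field_simp; ring
  simp only [smul_eq_mul, hv, gu, gv, gw] at h
  simp at h

/-- Between two nonnegative zeros of `negMulLog (t ^ 2)` minus a cubic, the derivative vanishes. -/
lemma exists_slope_eq {c₀ c₁ c₂ c₃ a b : ℝ} (ha : 0 ≤ a) (hab : a < b)
    (ea : negMulLog (a ^ 2) = c₀ + c₁ * a + c₂ * a ^ 2 + c₃ * a ^ 3)
    (eb : negMulLog (b ^ 2) = c₀ + c₁ * b + c₂ * b ^ 2 + c₃ * b ^ 3) :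
    ∃ t, a < t ∧ t < b ∧ entropySlope t - (c₁ + 2 * c₂ * t + 3 * c₃ * t ^ 2) = 0 := by
  have hderiv : ∀ t ∈ Set.Ioo a b, HasDerivAt
      (fun u => negMulLog (u ^ 2) - (c₀ + c₁ * u + c₂ * u ^ 2 + c₃ * u ^ 3))
      (entropySlope t - (c₁ + 2 * c₂ * t + 3 * c₃ * t ^ 2)) t := fun t ht => by
    refine (hasDerivAt_negMulLog_sq (ha.trans_lt ht.1)).sub ?_
    have h := (((hasDerivAt_const t c₀).add ((hasDerivAt_id t).const_mul c₁)).add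
      ((hasDerivAt_pow 2 t).const_mul c₂)).add ((hasDerivAt_pow 3 t).const_mul c₃)
    refine h.congr_deriv ?_
    push_cast
    ring
  obtain ⟨t, ht, h⟩ := exists_hasDerivAt_eq_zero hab (by fun_prop) (by simp [ea, eb]) hderiv
  exact ⟨t, ht.1, ht.2, h⟩

/-- Rolle turns four common points into three zeros of the difference of derivatives. If `0 ≤ c₃`
that difference is strictly concave and has at most two. -/
lemma cubic_coeff_neg_of_four_points {c₀ c₁ c₂ c₃ x y z w : ℝ} (hx : 0 ≤ x) (hxy : x < y)
    (hyz : y < z) (hzw : z < w)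
    (h : ∀ t, t = x ∨ t = y ∨ t = z ∨ t = w →
      negMulLog (t ^ 2) = c₀ + c₁ * t + c₂ * t ^ 2 + c₃ * t ^ 3) : c₃ < 0 := by
  by_contra! hc
  obtain ⟨p, hp, hp', ep⟩ := exists_slope_eq hx hxy (h x (by simp)) (h y (by simp))
  obtain ⟨q, hq, hq', eq⟩ := exists_slope_eq (hx.trans hxy.le) hyz (h y (by simp)) (h z (by simp))
  obtain ⟨r, hr, hr', er⟩ := exists_slope_eq (by linarith) hzw (h z (by simp)) (h w (by simp))
  exact not_three_zeros_of_strictConcaveOn (strictConcaveOn_entropySlope_sub hc) (u := p) (v := q) (w := r)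
    (Set.mem_Ici.2 (by linarith)) (Set.mem_Ici.2 (by linarith)) (by linarith) (by linarith) ep eq er

/-- The confluent case: tangency at `P` supplies one zero of the derivative and Rolle supplies two
more, wherever `P` lies relative to `x` and `y`. -/
lemma cubic_coeff_neg_of_tangent {c₀ c₁ c₂ c₃ P x y : ℝ} (hP : 0 < P) (hx : 0 ≤ x) (hy : 0 ≤ y)
    (hxy : x ≠ y) (hxP : x ≠ P) (hyP : y ≠ P)
    (h : ∀ t, t = P ∨ t = x ∨ t = y →
      negMulLog (t ^ 2) = c₀ + c₁ * t + c₂ * t ^ 2 + c₃ * t ^ 3)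
    (hs : entropySlope P = c₁ + 2 * c₂ * P + 3 * c₃ * P ^ 2) : c₃ < 0 := by
  wlog hlt : x < y generalizing x y
  · exact this hy hx hxy.symm hyP hxP (fun t ht => h t (by tauto))
      (lt_of_le_of_ne (not_lt.1 hlt) hxy.symm)
  by_contra! hc
  have eP := h P (by simp)
  have ex := h x (by simp)
  have ey := h y (by simp)
  have hs' := sub_eq_zero.2 hs
  have key := strictConcaveOn_entropySlope_sub (c₁ := c₁) (c₂ := c₂) hc
  rcases lt_or_gt_of_ne hxP with h1 | h1
  · rcases lt_or_gt_of_ne hyP with h2 | h2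
    · obtain ⟨p, hp, hp', ep⟩ := exists_slope_eq hx hlt ex ey
      obtain ⟨q, hq, hq', eq⟩ := exists_slope_eq hy h2 ey eP
      exact not_three_zeros_of_strictConcaveOn key (Set.mem_Ici.2 (by linarith)) (Set.mem_Ici.2 (by linarith))
        (by linarith : p < q) hq' ep eq hs'
    · obtain ⟨p, hp, hp', ep⟩ := exists_slope_eq hx h1 ex eP
      obtain ⟨q, hq, hq', eq⟩ := exists_slope_eq hP.le h2 eP ey
      exact not_three_zeros_of_strictConcaveOn key (Set.mem_Ici.2 (by linarith)) (Set.mem_Ici.2 (by linarith))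
        hp' hq ep hs' eq
  · obtain ⟨p, hp, hp', ep⟩ := exists_slope_eq hP.le h1 eP ex
    obtain ⟨q, hq, hq', eq⟩ := exists_slope_eq hx hlt ex ey
    exact not_three_zeros_of_strictConcaveOn key (Set.mem_Ici.2 hP.le) (Set.mem_Ici.2 (by linarith))
      hp (by linarith : p < q) hs' ep eq

/-- Hermite interpolation of `negMulLog (t ^ 2)` by a quadratic, with a double node at `P` and a
simple node at `Q`, and the sign of the error. -/
lemma exists_tangent_quadratic {P Q : ℝ} (hP : 0 < P) (hQ : 0 ≤ Q) (hPQ : Q ≠ P) :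
    ∃ c₀ c₁ c₂ : ℝ, negMulLog (P ^ 2) = c₀ + c₁ * P + c₂ * P ^ 2 ∧
      negMulLog (Q ^ 2) = c₀ + c₁ * Q + c₂ * Q ^ 2 ∧
      ∀ t, 0 ≤ t → t ≠ P → t ≠ Q →
        (negMulLog (t ^ 2) - (c₀ + c₁ * t + c₂ * t ^ 2)) * (t - Q) < 0 := by
  have hQP : Q - P ≠ 0 := sub_ne_zero.2 hPQ
  obtain ⟨M, hM⟩ : ∃ M, negMulLog (Q ^ 2) - negMulLog (P ^ 2) - entropySlope P * (Q - P)
      = M * (Q - P) ^ 2 := ⟨_, (div_mul_cancel₀ _ (pow_ne_zero 2 hQP)).symm⟩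
  refine ⟨negMulLog (P ^ 2) - entropySlope P * P + M * P ^ 2, entropySlope P - 2 * M * P, M,
    by ring, by linear_combination hM, fun t ht htP htQ => ?_⟩
  have htP' : t - P ≠ 0 := sub_ne_zero.2 htP
  have htQ' : t - Q ≠ 0 := sub_ne_zero.2 htQ
  -- With `K` so chosen, the quadratic plus `K (u - P)² (u - Q)` is a cubic that also meets the
  -- function at `u = t`; its leading coefficient `K` is therefore negative.
  obtain ⟨K, hK⟩ : ∃ K, negMulLog (t ^ 2) - (negMulLog (P ^ 2) - entropySlope P * P + M * P ^ 2
      + (entropySlope P - 2 * M * P) * t + M * t ^ 2) = K * ((t - P) ^ 2 * (t - Q)) :=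
    ⟨_, (div_mul_cancel₀ _ (mul_ne_zero (pow_ne_zero 2 htP') htQ')).symm⟩
  have hneg : K < 0 := by
    refine cubic_coeff_neg_of_tangent (P := P) (x := Q) (y := t)
      (c₀ := negMulLog (P ^ 2) - entropySlope P * P + M * P ^ 2 - K * P ^ 2 * Q)
      (c₁ := entropySlope P - 2 * M * P + K * (P ^ 2 + 2 * P * Q))
      (c₂ := M - K * (2 * P + Q)) hP hQ ht htQ.symm hPQ htP ?_ (by ring)
    rintro u (rfl | rfl | rfl)
    · ring
    · linear_combination hM
    · linear_combination hK
  rw [hK]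
  have : 0 < (t - P) ^ 2 * (t - Q) ^ 2 := by positivity
  nlinarith

/-- Lagrange interpolation of `negMulLog (t ^ 2)` at `0 < y < z`, and the sign of the error. -/
lemma exists_secant_quadratic {y z : ℝ} (hy : 0 < y) (hyz : y < z) :
    ∃ c₁ c₂ : ℝ, negMulLog (y ^ 2) = c₁ * y + c₂ * y ^ 2 ∧
      negMulLog (z ^ 2) = c₁ * z + c₂ * z ^ 2 ∧
      ∀ t, 0 < t → 0 < t * (t - y) * (t - z) →
        negMulLog (t ^ 2) < c₁ * t + c₂ * t ^ 2 := by
  obtain ⟨A, hA⟩ : ∃ A, negMulLog (y ^ 2) = A * y := ⟨_, (div_mul_cancel₀ _ hy.ne').symm⟩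
  obtain ⟨M, hM⟩ : ∃ M, negMulLog (z ^ 2) - A * z = M * (z * (z - y)) :=
    ⟨_, (div_mul_cancel₀ _ (mul_ne_zero (by linarith) (by linarith))).symm⟩
  refine ⟨A - M * y, M, by linear_combination hA, by linear_combination hM, fun t ht hpos => ?_⟩
  obtain ⟨K, hK⟩ : ∃ K, negMulLog (t ^ 2) - ((A - M * y) * t + M * t ^ 2)
      = K * (t * (t - y) * (t - z)) := ⟨_, (div_mul_cancel₀ _ hpos.ne').symm⟩
  have hall : ∀ u, u = 0 ∨ u = y ∨ u = z ∨ u = t → negMulLog (u ^ 2)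
      = 0 + (A - M * y + K * (y * z)) * u + (M - K * (y + z)) * u ^ 2 + K * u ^ 3 := by
    rintro u (rfl | rfl | rfl | rfl)
    · simp
    · linear_combination hA
    · linear_combination hM
    · linear_combination hK
  have hty : t ≠ y := by rintro rfl; simp at hpos
  have htz : t ≠ z := by rintro rfl; simp at hpos
  have hneg : K < 0 := by
    rcases lt_or_gt_of_ne hty with h | h
    · exact cubic_coeff_neg_of_four_points le_rfl ht h hyz fun u hu => hall u (by tauto)
    · rcases lt_or_gt_of_ne htz with h' | h'
      · exact cubic_coeff_neg_of_four_points le_rfl hy h h' fun u hu => hall u (by tauto)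
      · exact cubic_coeff_neg_of_four_points le_rfl hy hyz h' fun u hu => hall u (by tauto)
  nlinarith

/-! ### Vectors of the form `profile`. -/

lemma sum_profile {N k : ℕ} (hk : 1 ≤ k) (hkN : k ≤ N) (x : ℝ) {g : ℝ → ℝ} (g0 : g 0 = 0) :
    ∑ i, g (profile N k x i) = g x + ((k : ℝ) - 1) * g ((1 - x) / ((k : ℝ) - 1)) := by
  obtain ⟨m, rfl⟩ : ∃ m, k = m + 1 := ⟨k - 1, by omega⟩
  obtain ⟨M, rfl⟩ : ∃ M, N = M + 1 := ⟨N - 1, by omega⟩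
  rw [Fin.sum_univ_succ]
  have h : ∀ i : Fin M, g (profile (M + 1) (m + 1) x i.succ)
      = if (i : ℕ) < m then g ((1 - x) / (((m + 1 : ℕ) : ℝ) - 1)) else 0 := fun i => by
    simp only [profile, Fin.val_succ, Nat.succ_ne_zero, if_false, Nat.add_lt_add_iff_right]
    split_ifs <;> simp [g0]
  simp_rw [h]
  rw [Fin.sum_univ_eq_sum_range
    (fun i => if i < m then g ((1 - x) / (((m + 1 : ℕ) : ℝ) - 1)) else 0) M,
    ← Finset.sum_filter, Finset.sum_const]
  have hf : (Finset.range M).filter (· < m) = Finset.range m := by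
    ext i; simp; omega
  rw [hf]
  simp [profile]

lemma entropyBound_mul_log {k : ℕ} {x : ℝ} (hk : k = 1 → x = 1) :
    negMulLog x + ((k : ℝ) - 1) * negMulLog ((1 - x) / ((k : ℝ) - 1))
      = entropyBound x k * log 2 := by
  have hlog : log 2 ≠ 0 := (log_pos one_lt_two).ne'
  rcases eq_or_ne x 1 with rfl | hx
  · simp [entropyBound, H₂]
  · have hk2 : ((k : ℝ) - 1) ≠ 0 := fun h => hx (hk (by exact_mod_cast sub_eq_zero.1 h))
    have hx' : 1 - x ≠ 0 := sub_ne_zero.2 hx.symm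
    rw [entropyBound, H₂, logb, logb, logb, negMulLog, negMulLog, log_div hx' hk2]
    field_simp
    ring

lemma sum_negMulLog_eq_of_perm_profile {N k : ℕ} (hk : 1 ≤ k) (hkN : k ≤ N) {p : Fin N → ℝ}
    {x : ℝ} (h1 : k = 1 → x = 1) {σ : Equiv.Perm (Fin N)}
    (h : ∀ i, p (σ i) = profile N k x i) :
    ∑ i, negMulLog (p i) = entropyBound x k * log 2 := by
  rw [← entropyBound_mul_log h1, ← sum_profile hk hkN x negMulLog_zero, ← Equiv.sum_comp σ]
  simp_rw [h]

/-- A vector with one distinguished nonzero entry and all other nonzero entries equal is a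
rearrangement of a `profile`. -/
lemma exists_perm_eq_profile {N k : ℕ} {p : Fin N → ℝ} {x : ℝ} {i₀ : Fin N}
    (hcard : (Finset.univ.filter fun i => p i ≠ 0).card = k) (hx : p i₀ = x) (hne : p i₀ ≠ 0)
    (hc : ∀ i, p i ≠ 0 → i ≠ i₀ → p i = (1 - x) / ((k : ℝ) - 1)) :
    ∃ σ : Equiv.Perm (Fin N), ∀ i, p (σ i) = profile N k x i := by
  have hkN : k ≤ N := by
    rw [← hcard]; simpa using Finset.card_le_univ (Finset.univ.filter fun i => p i ≠ 0)
  have hk : 0 < k := by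
    rw [← hcard]; exact Finset.card_pos.2 ⟨i₀, by simpa using hne⟩
  have e : {i : Fin N // (i : ℕ) < k} ≃ {i : Fin N // p i ≠ 0} := by
    refine Fintype.equivOfCardEq ?_
    rw [Fintype.card_subtype, Fintype.card_subtype, hcard]
    have : (Finset.univ.filter fun i : Fin N => (i : ℕ) < k)
        = (Finset.range k).attachFin fun i hi => by
          have := Finset.mem_range.1 hi; omega := by
      ext i; simp
    rw [this, Finset.card_attachFin, Finset.card_range]
  let τ := e.extendSubtype
  have hτ : ∀ i, p (τ i) ≠ 0 ↔ (i : ℕ) < k := fun i =>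
    ⟨fun h => by_contra fun hi => e.extendSubtype_not_mem i hi h, e.extendSubtype_mem i⟩
  let z : Fin N := ⟨0, by omega⟩
  -- `τ` matches the first `k` indices with the support; the swap then moves the image of index `0`
  -- to `i₀`.
  refine ⟨τ.trans (Equiv.swap (τ z) i₀), fun i => ?_⟩
  simp only [Equiv.trans_apply, profile]
  by_cases hi : (i : ℕ) = 0
  · have : i = z := Fin.ext hi
    simp [this, z, hx]
  · have hiz : τ i ≠ τ z := fun h => hi (congrArg Fin.val (τ.injective h))
    rw [if_neg hi]
    by_cases hi0 : τ i = i₀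
    · have hik : (i : ℕ) < k := (hτ i).1 (by rwa [hi0])
      rw [hi0, Equiv.swap_apply_right, if_pos hik]
      exact hc _ ((hτ z).2 hk) fun h => hiz (hi0.trans h.symm)
    · rw [Equiv.swap_apply_of_ne_of_ne hiz hi0]
      split_ifs with hik
      · exact hc _ ((hτ i).2 hik) hi0
      · exact not_not.1 fun h => hik ((hτ i).1 h)

/-! ### The numbers `α` and `β` as squares of amplitudes. -/

section Parameters

variable {b : ℝ} {k : ℕ}

/-- The rational part of the numerator is `(b + 1) + (k - 1)(k - 1 - b)` and the root is twice the
product of the two square roots, so the numerator is a perfect square. -/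
lemma alpha_eq_sq (hb : 0 ≤ b) (hbk : b ≤ (k : ℝ) - 1) :
    alpha b k = ((√(b + 1) + √(((k : ℝ) - 1) * ((k : ℝ) - 1 - b))) / k) ^ 2 := by
  have h1 := sq_sqrt (by linarith : 0 ≤ b + 1)
  have h2 := sq_sqrt (mul_nonneg (by linarith : (0 : ℝ) ≤ (k : ℝ) - 1)
    (by linarith : (0 : ℝ) ≤ (k : ℝ) - 1 - b))
  rw [alpha, div_pow, mul_assoc (b + 1), sqrt_mul (by linarith)]
  congr 1
  linear_combination -h1 - h2

lemma beta_eq_sq (hb : 0 ≤ b) (hbk : b ≤ (k : ℝ) - 1) :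
    beta b k = ((√(b + 1) - √(((k : ℝ) - 1) * ((k : ℝ) - 1 - b))) / k) ^ 2 := by
  have h1 := sq_sqrt (by linarith : 0 ≤ b + 1)
  have h2 := sq_sqrt (mul_nonneg (by linarith : (0 : ℝ) ≤ (k : ℝ) - 1)
    (by linarith : (0 : ℝ) ≤ (k : ℝ) - 1 - b))
  rw [beta, div_pow, mul_assoc (b + 1), sqrt_mul (by linarith)]
  congr 1
  linear_combination -h1 - h2

/-- The equation satisfied by the distinguished amplitude, in its two solutions `(s ± w) / k`. -/
lemma sq_sub_eq_of_sq_eq {s w k : ℝ} (hk : k ≠ 0) (hw : w ^ 2 = (k - 1) * (k - s ^ 2)) :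
    (s - (s + w) / k) ^ 2 = (k - 1) * (1 - ((s + w) / k) ^ 2) := by
  field_simp
  linear_combination k * hw

/-- This says that the larger solution `(s + w) / k` is at most `s`, leaving a nonnegative sum for
the other amplitudes. -/
lemma sqrt_le_mul_sqrt (hb : 0 ≤ b) (hbk : b ≤ (k : ℝ) - 1) :
    √(((k : ℝ) - 1) * ((k : ℝ) - 1 - b)) ≤ ((k : ℝ) - 1) * √(b + 1) := by
  have h1 := sq_sqrt (by linarith : 0 ≤ b + 1)
  refine sqrt_le_iff.2 ⟨mul_nonneg (by linarith) (sqrt_nonneg _), ?_⟩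
  rw [mul_pow, h1, sq, mul_assoc]
  refine mul_le_mul_of_nonneg_left ?_ (by linarith)
  nlinarith

end Parameters

/-- The pure state with nonnegative amplitudes whose diagonal is a given `profile`. -/
lemma exists_state_of_profile {N k : ℕ} (hk : 1 ≤ k) (hkN : k ≤ N) {s A : ℝ} (hA : 0 ≤ A)
    (hAs : A ≤ s) (h : (s - A) ^ 2 = ((k : ℝ) - 1) * (1 - A ^ 2)) (h1 : k = 1 → A = 1) :
    ∃ ψ : EuclideanSpace ℂ (Fin N), ‖ψ‖ = 1 ∧ ∑ i, ‖ψ i‖ = s ∧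
      ∀ i, ‖ψ i‖ ^ 2 = profile N k (A ^ 2) i := by
  have hk0 : (0 : ℝ) ≤ (k : ℝ) - 1 := by
    have : (1 : ℝ) ≤ k := by exact_mod_cast hk
    linarith
  have hc : ((k : ℝ) - 1) * ((1 - A ^ 2) / ((k : ℝ) - 1)) = 1 - A ^ 2 ∧
      ((k : ℝ) - 1) * √((1 - A ^ 2) / ((k : ℝ) - 1)) = s - A ∧
      0 ≤ (1 - A ^ 2) / ((k : ℝ) - 1) := by
    rcases hk0.eq_or_lt with h0 | h0
    · have hk1 : k = 1 := by exact_mod_cast (sub_eq_zero.1 h0.symm)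
      rw [← h0, zero_mul] at h
      have := pow_eq_zero_iff (two_ne_zero) |>.1 h
      rw [← h0, h1 hk1]
      simp
      rw [h1 hk1] at this
      linarith
    · have hdiv : (1 - A ^ 2) / ((k : ℝ) - 1) = ((s - A) / ((k : ℝ) - 1)) ^ 2 := by
        field_simp; linarith
      refine ⟨mul_div_cancel₀ _ h0.ne', ?_, by rw [hdiv]; positivity⟩
      rw [hdiv, sqrt_sq (div_nonneg (by linarith) h0.le), mul_div_cancel₀ _ h0.ne']
  have hnn : ∀ i, 0 ≤ profile N k (A ^ 2) i := fun i => by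
    simp only [profile]
    split_ifs
    · positivity
    · exact hc.2.2
    · exact le_rfl
  have hsq : ∀ i, ‖((√(profile N k (A ^ 2) i) : ℝ) : ℂ)‖ = √(profile N k (A ^ 2) i) := fun i => by
    rw [Complex.norm_real, norm_of_nonneg (sqrt_nonneg _)]
  refine ⟨WithLp.toLp 2 fun i => ((√(profile N k (A ^ 2) i) : ℝ) : ℂ), ?_, ?_, fun i => ?_⟩
  · rw [EuclideanSpace.norm_eq]
    simp only [hsq, sq_sqrt (hnn _)]
    have := sum_profile hk hkN (A ^ 2) (g := fun t => t) rfl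
    rw [this, hc.1]
    simp
  · simp only [hsq]
    rw [sum_profile hk hkN (A ^ 2) sqrt_zero, hc.2.1, sqrt_sq hA]
    ring
  · simp only [hsq, sq_sqrt (hnn _)]

lemma card_support_profile {N k : ℕ} (hk : 1 ≤ k) (hkN : k ≤ N) {x : ℝ} (hx : x ≠ 0)
    (hx' : k ≠ 1 → x ≠ 1) :
    (Finset.univ.filter fun i => profile N k x i ≠ 0).card = k := by
  -- Summing the indicator of nonzero values counts the support.
  have h := sum_profile hk hkN x (g := fun t => if t ≠ 0 then 1 else 0) (by simp)
  rw [Finset.sum_boole, if_pos hx] at h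
  have hk' : ((k : ℝ) - 1) * (if (1 - x) / ((k : ℝ) - 1) ≠ 0 then (1 : ℝ) else 0) = (k : ℝ) - 1 := by
    rcases eq_or_ne k 1 with rfl | hk1
    · simp
    · rw [if_pos, mul_one]
      exact div_ne_zero (sub_ne_zero.2 (hx' hk1).symm)
        (sub_ne_zero.2 (by exact_mod_cast hk1))
  rw [hk'] at h
  have : (((Finset.univ.filter fun i => profile N k x i ≠ 0).card : ℕ) : ℝ) = k := by
    rw [h]; ring
  exact_mod_cast this

/-! ### The lower bound. -/

lemma sum_filter_ne_zero {N : ℕ} {x : Fin N → ℝ} {g : ℝ → ℝ} (g0 : g 0 = 0) :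
    ∑ i with x i ≠ 0, g (x i) = ∑ i, g (x i) :=
  Finset.sum_filter_of_ne fun i _ h hx => h (by rw [hx, g0])

/-- The least entropy for a given sum of amplitudes and a given size of the support. -/
theorem entropyBound_le_sum_negMulLog {N d : ℕ} {x : Fin N → ℝ} {b : ℝ} (hx : ∀ i, 0 ≤ x i)
    (hb : 0 ≤ b) (hbd : b ≤ (d : ℝ) - 1) (hsum : ∑ i, x i = √(b + 1)) (hsq : ∑ i, x i ^ 2 = 1)
    (hd : (Finset.univ.filter fun i => x i ≠ 0).card = d) :
    entropyBound (alpha b d) d * log 2 ≤ ∑ i, negMulLog (x i ^ 2) ∧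
    (∑ i, negMulLog (x i ^ 2) = entropyBound (alpha b d) d * log 2 →
      ∃ σ : Equiv.Perm (Fin N), ∀ i, x (σ i) ^ 2 = profile N d (alpha b d) i) := by
  have hd1 : (1 : ℝ) ≤ d := by linarith
  have hd1' : 1 ≤ d := by exact_mod_cast hd1
  have hd0 : (d : ℝ) ≠ 0 := by linarith
  have hdN : d ≤ N := by
    rw [← hd]; simpa using Finset.card_le_univ (Finset.univ.filter fun i => x i ≠ 0)
  set S := Finset.univ.filter fun i => x i ≠ 0 with hS
  have hmem : ∀ i, i ∈ S ↔ x i ≠ 0 := fun i => by simp [hS]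
  set s := √(b + 1) with hs
  have hs2 : s ^ 2 = b + 1 := sq_sqrt (by linarith)
  have hs0 : 0 ≤ s := sqrt_nonneg _
  set w := √(((d : ℝ) - 1) * ((d : ℝ) - 1 - b)) with hw
  have hw2 : w ^ 2 = ((d : ℝ) - 1) * (d - s ^ 2) := by
    rw [hw, sq_sqrt (mul_nonneg (by linarith) (by linarith)), hs2]; ring
  have hw0 : 0 ≤ w := sqrt_nonneg _
  have hA0 : alpha b d = ((s + w) / d) ^ 2 := alpha_eq_sq hb hbd
  have hroot := sq_sub_eq_of_sq_eq hd0 hw2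
  set A := (s + w) / d with hA
  have hspos : 0 < s := sqrt_pos.2 (by linarith)
  have hApos : 0 < A := by positivity
  have hAs : A ≤ s := by
    rw [hA, div_le_iff₀ (by linarith)]
    linarith [sqrt_le_mul_sqrt hb hbd]
  set c := (s - A) / ((d : ℝ) - 1) with hc
  have hSsum : ∑ i ∈ S, x i = s := by rw [← hsum]; exact sum_filter_ne_zero (g := fun t => t) rfl
  have hSsq : ∑ i ∈ S, x i ^ 2 = 1 := by
    rw [← hsq]; exact sum_filter_ne_zero (g := fun t => t ^ 2) (by simp)
  have hSent : ∑ i ∈ S, negMulLog (x i ^ 2) = ∑ i, negMulLog (x i ^ 2) :=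
    sum_filter_ne_zero (g := fun t => negMulLog (t ^ 2)) (by simp)
  -- Cauchy–Schwarz on the other `d - 1` amplitudes gives `(s - x i)² ≤ (d - 1)(1 - x i²)`, that is
  -- `(d x i - s)² ≤ w²`.
  have hle : ∀ i ∈ S, x i ≤ A := fun i hi => by
    have h := sq_sum_le_card_mul_sum_sq (s := S.erase i) (f := x)
    rw [Finset.card_erase_of_mem hi, hd] at h
    have e1 := Finset.add_sum_erase S x hi
    have e2 := Finset.add_sum_erase S (fun i => x i ^ 2) hi
    rw [hSsum] at e1
    rw [hSsq] at e2
    rw [show ∑ j ∈ S.erase i, x j = s - x i by linarith,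
      show ∑ j ∈ S.erase i, x j ^ 2 = 1 - x i ^ 2 by linarith, Nat.cast_sub hd1', Nat.cast_one] at h
    have h3 : (d * x i - s) ^ 2 ≤ w ^ 2 := by rw [hw2]; nlinarith
    have h4 := abs_le_of_sq_le_sq' h3 hw0
    rw [hA, le_div_iff₀ (by linarith)]
    linarith [h4.2]
  have hone : d = 1 → alpha b d = 1 := fun h => by
    have hd' : (d : ℝ) = 1 := by exact_mod_cast h
    have hb0 : b = 0 := by linarith
    rw [alpha, hd', hb0]; norm_num
  have hc2 : d ≠ 1 → c ^ 2 = (1 - A ^ 2) / ((d : ℝ) - 1) := fun h => by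
    have : (d : ℝ) - 1 ≠ 0 := sub_ne_zero.2 (by exact_mod_cast h)
    rw [hc, div_pow, hroot]; field_simp
  have hcard2 : (Finset.univ.filter fun i => x i ^ 2 ≠ 0).card = d := by simpa using hd
  have hstruct : ∀ i₀ ∈ S, x i₀ = A → (∀ i ∈ S, i ≠ i₀ → x i = c) →
      ∃ σ : Equiv.Perm (Fin N), ∀ i, x (σ i) ^ 2 = profile N d (alpha b d) i := by
    intro i₀ hi₀ e₀ hi
    refine exists_perm_eq_profile (p := fun i => x i ^ 2) hcard2 (i₀ := i₀) (by rw [e₀, hA0])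
      (pow_ne_zero 2 ((hmem _).1 hi₀)) fun i hi1 hi2 => ?_
    have hiS : i ∈ S := (hmem i).2 fun h => hi1 (by simp [h])
    have hd1 : d ≠ 1 := fun h => hi2 (Finset.card_le_one.1 (by rw [hd, h]) _ hiS _ hi₀)
    rw [hi i hiS hi2, hc2 hd1, hA0]
  have hfin : (∃ σ : Equiv.Perm (Fin N), ∀ i, x (σ i) ^ 2 = profile N d (alpha b d) i) →
      ∑ i, negMulLog (x i ^ 2) = entropyBound (alpha b d) d * log 2 := fun ⟨σ, h⟩ =>
    sum_negMulLog_eq_of_perm_profile hd1' hdN hone (p := fun i => x i ^ 2) h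
  -- If all nonzero amplitudes equal `A`, the nodes `c` and `A` may coincide or `d` may be `1`; the
  -- profile is then read off directly. Otherwise `0 < c` and `c ≠ A`, as the interpolation needs.
  by_cases hall : ∀ i ∈ S, x i = A
  · obtain ⟨i₀, hi₀⟩ : S.Nonempty := Finset.card_pos.1 (by omega)
    have h := hstruct i₀ hi₀ (hall _ hi₀) fun i hi hne => by
      have h1 := hSsum
      rw [Finset.sum_congr rfl hall, Finset.sum_const, hd, nsmul_eq_mul] at h1
      have hd1 : d ≠ 1 := fun h => hne (Finset.card_le_one.1 (by rw [hd, h]) _ hi _ hi₀)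
      have : (d : ℝ) - 1 ≠ 0 := sub_ne_zero.2 (by exact_mod_cast hd1)
      rw [hall i hi, hc]
      field_simp
      linarith
    exact ⟨(hfin h).ge, fun _ => h⟩
  have hdne : d ≠ 1 := fun h => hall fun i hi => by
    have : S = {i} := by
      obtain ⟨j, hj⟩ := Finset.card_eq_one.1 (hd.trans h)
      rw [hj] at hi ⊢
      rw [Finset.mem_singleton.1 hi]
    have h1 := hSsum
    have h2 := hle i hi
    rw [this, Finset.sum_singleton] at h1
    linarith
  have hd1pos : 0 < (d : ℝ) - 1 := by
    refine lt_of_le_of_ne (by linarith) fun h => hdne ?_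
    exact_mod_cast (sub_eq_zero.1 h.symm)
  have hcA : A + (d - 1) * c = s := by rw [hc]; field_simp; ring
  have hcA2 : A ^ 2 + (d - 1) * c ^ 2 = 1 := by rw [hc2 hdne]; field_simp; ring
  have hcpos : 0 < c := by
    refine div_pos (sub_pos.2 (lt_of_le_of_ne hAs fun h => hall ?_)) hd1pos
    rw [← h, sub_self] at hroot
    have hA1 : A ^ 2 = 1 := by nlinarith
    -- If `c = 0`, then `A = s` and `A² = 1`, so this sum of nonnegative terms is `A s - 1 = 0`,
    -- forcing all nonzero amplitudes to be `A`.
    have hz : ∑ i ∈ S, x i * (A - x i) = 0 := by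
      simp_rw [mul_sub, ← sq, Finset.sum_sub_distrib, ← Finset.sum_mul, hSsum, hSsq, ← h, ← sq, hA1]
      simp
    have := (Finset.sum_eq_zero_iff_of_nonneg fun i hi =>
      mul_nonneg (hx i) (sub_nonneg.2 (hle i hi))).1 hz
    intro i hi
    have h1 := (mul_eq_zero.1 (this i hi)).resolve_left ((hmem i).1 hi)
    linarith
  have hAc : A ≠ c := fun h => hall <| by
    rw [← h] at hcA
    have hz : ∑ i ∈ S, (A - x i) = 0 := by
      rw [Finset.sum_sub_distrib, hSsum, Finset.sum_const, hd, nsmul_eq_mul]; linarith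
    have := (Finset.sum_eq_zero_iff_of_nonneg fun i hi => sub_nonneg.2 (hle i hi)).1 hz
    intro i hi
    linarith [this i hi]
  obtain ⟨c₀, c₁, c₂, ec, eA, hlt⟩ := exists_tangent_quadratic hcpos hApos.le hAc
  have hnonneg : ∀ i ∈ S, 0 ≤ negMulLog (x i ^ 2) - (c₀ + c₁ * x i + c₂ * x i ^ 2) := fun i hi => by
    by_cases h1 : x i = c
    · rw [h1, ec]; simp
    · by_cases h2 : x i = A
      · rw [h2, eA]; simp
      · have h3 := hlt _ (hx i) h1 h2
        have h4 := hle i hi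
        by_contra! h5
        nlinarith
  have hpol : ∑ i ∈ S, (negMulLog (x i ^ 2) - (c₀ + c₁ * x i + c₂ * x i ^ 2))
      = ∑ i, negMulLog (x i ^ 2) - entropyBound (alpha b d) d * log 2 := by
    rw [← entropyBound_mul_log hone, hA0, ← hc2 hdne, ec, eA]
    simp_rw [Finset.sum_sub_distrib, Finset.sum_add_distrib, ← Finset.mul_sum, hSsum, hSsq, hSent,
      Finset.sum_const, hd, nsmul_eq_mul]
    linear_combination c₁ * hcA + c₂ * hcA2
  refine ⟨sub_nonneg.1 (hpol ▸ Finset.sum_nonneg hnonneg), fun heq => ?_⟩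
  rw [heq, sub_self] at hpol
  have hzero := (Finset.sum_eq_zero_iff_of_nonneg hnonneg).1 hpol
  have hval : ∀ i ∈ S, x i = c ∨ x i = A := fun i hi => by
    by_contra! h
    have := hlt _ (hx i) h.1 h.2
    rw [hzero i hi, zero_mul] at this
    exact this.false
  -- Since `s = A + (d - 1) c`, the sum of the `x i - c` over the support is `A - c`, so exactly one
  -- amplitude equals `A`.
  have hcount : ((S.filter fun i => x i = A).card : ℝ) * (A - c) = A - c := by
    have h1 : ∑ i ∈ S, (x i - c) = A - c := by
      rw [Finset.sum_sub_distrib, hSsum, Finset.sum_const, hd, nsmul_eq_mul]; linarith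
    have h2 : ∀ i ∈ S, x i - c = if x i = A then A - c else 0 := fun i hi => by
      split_ifs with h
      · rw [h]
      · rw [(hval i hi).resolve_right h, sub_self]
    rw [Finset.sum_congr rfl h2, ← Finset.sum_filter, Finset.sum_const, nsmul_eq_mul] at h1
    exact h1
  have hcard1 : (S.filter fun i => x i = A).card = 1 := by
    have := mul_right_cancel₀ (sub_ne_zero.2 hAc) (hcount.trans (one_mul _).symm)
    exact_mod_cast this
  obtain ⟨i₀, hi₀⟩ := Finset.card_eq_one.1 hcard1
  have hi₀' : i₀ ∈ S ∧ x i₀ = A := by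
    exact Finset.mem_filter.1 (hi₀ ▸ Finset.mem_singleton_self i₀)
  refine hstruct i₀ hi₀'.1 hi₀'.2 fun i hi hne => (hval i hi).resolve_right fun h => hne ?_
  rw [← Finset.mem_singleton, ← hi₀, Finset.mem_filter]
  exact ⟨hi, h⟩

/-! ### The upper bound: improving a triple, then compactness. -/

/-- The new triple is `(C, D, D)` with `C = (e - 2r)/3` and `D = (e + r)/3`; `hcase` is exactly `0 ≤
C`. By Cauchy–Schwarz `C` is the least value an entry can take, and above `C` the quadratic tangent
at `D` and meeting at `C` dominates the function. -/
lemma exists_triple_entropy_lt_of_le {x y z e q : ℝ} (hx : 0 < x) (hxy : x ≤ y) (hyz : y < z)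
    (he : e = x + y + z) (hq : q = x ^ 2 + y ^ 2 + z ^ 2) (hcase : 2 * q ≤ e ^ 2) :
    ∃ x' y' z' : ℝ, 0 ≤ x' ∧ 0 ≤ y' ∧ 0 ≤ z' ∧ x' + y' + z' = e ∧
      x' ^ 2 + y' ^ 2 + z' ^ 2 = q ∧
      negMulLog (x ^ 2) + negMulLog (y ^ 2) + negMulLog (z ^ 2)
        < negMulLog (x' ^ 2) + negMulLog (y' ^ 2) + negMulLog (z' ^ 2) := by
  have hrad : 0 < (3 * q - e ^ 2) / 2 := by
    have : 3 * q - e ^ 2 = (x - y) ^ 2 + (x - z) ^ 2 + (y - z) ^ 2 := by rw [he, hq]; ring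
    rw [this]
    have := pow_pos (sub_pos.2 hyz) 2
    nlinarith [sq_nonneg (x - y), sq_nonneg (x - z)]
  set r := √((3 * q - e ^ 2) / 2) with hr
  have hr2 : r ^ 2 = (3 * q - e ^ 2) / 2 := sq_sqrt hrad.le
  have hr0 : 0 < r := sqrt_pos.2 hrad
  have hepos : 0 < e := by linarith
  have hC : 0 ≤ (e - 2 * r) / 3 := by
    have : (2 * r) ^ 2 ≤ e ^ 2 := by nlinarith
    have := abs_le_of_sq_le_sq' this hepos.le
    linarith [this.2]
  have hlow : ∀ t, (e - t) ^ 2 ≤ 2 * (q - t ^ 2) → (e - 2 * r) / 3 ≤ t := fun t ht => by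
    have : (3 * t - e) ^ 2 ≤ (2 * r) ^ 2 := by nlinarith
    have := abs_le_of_sq_le_sq' this (by positivity)
    linarith [this.1]
  have hCD : (e - 2 * r) / 3 ≠ (e + r) / 3 := by intro h; linarith
  obtain ⟨c₀, c₁, c₂, eD, eC, hlt⟩ := exists_tangent_quadratic (P := (e + r) / 3) (by positivity)
    hC hCD
  have hle : ∀ t, 0 < t → (e - t) ^ 2 ≤ 2 * (q - t ^ 2) →
      negMulLog (t ^ 2) ≤ c₀ + c₁ * t + c₂ * t ^ 2 := fun t ht h => by
    by_cases h1 : t = (e + r) / 3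
    · rw [h1, eD]
    · by_cases h2 : t = (e - 2 * r) / 3
      · rw [h2, eC]
      · have h3 := hlt t ht.le h1 h2
        have h4 := hlow t h
        by_contra! h5
        nlinarith
  have hcx : (e - x) ^ 2 ≤ 2 * (q - x ^ 2) := by
    have : (e - x) ^ 2 - 2 * (q - x ^ 2) = -(y - z) ^ 2 := by rw [he, hq]; ring
    linarith [sq_nonneg (y - z)]
  have hcy : (e - y) ^ 2 ≤ 2 * (q - y ^ 2) := by
    have : (e - y) ^ 2 - 2 * (q - y ^ 2) = -(x - z) ^ 2 := by rw [he, hq]; ring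
    linarith [sq_nonneg (x - z)]
  have hcz : (e - z) ^ 2 ≤ 2 * (q - z ^ 2) := by
    have : (e - z) ^ 2 - 2 * (q - z ^ 2) = -(x - y) ^ 2 := by rw [he, hq]; ring
    linarith [sq_nonneg (x - y)]
  -- Strictness comes from `x`: it is below the mean `e / 3`, hence not `D`, and it equals `C` only
  -- if `y = z`.
  have hxs : negMulLog (x ^ 2) < c₀ + c₁ * x + c₂ * x ^ 2 := by
    have h1 : x ≠ (e + r) / 3 := by intro h; linarith
    have h2 : x ≠ (e - 2 * r) / 3 := by
      intro h
      have h3 : (3 * x - e) ^ 2 = 4 * r ^ 2 := by rw [h]; ring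
      have h4 : (3 * x - e) ^ 2 - 4 * r ^ 2 = -3 * (y - z) ^ 2 := by rw [hr2, he, hq]; ring
      have := pow_pos (sub_pos.2 hyz) 2
      nlinarith
    have h3 := hlt x hx.le h1 h2
    have h4 := hlow x hcx
    by_contra! h5
    nlinarith
  have hyle := hle y (by linarith) hcy
  have hzle := hle z (by linarith) hcz
  refine ⟨(e - 2 * r) / 3, (e + r) / 3, (e + r) / 3, hC, by positivity, by positivity, by ring,
    by linear_combination (2 / 3) * hr2, ?_⟩
  rw [eC, eD]
  have hsum : c₁ * x + c₁ * y + c₁ * z = c₁ * e := by rw [he]; ring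
  have hsq : c₂ * x ^ 2 + c₂ * y ^ 2 + c₂ * z ^ 2 = c₂ * q := by rw [hq]; ring
  have htot : c₂ * ((e - 2 * r) / 3) ^ 2 + 2 * (c₂ * ((e + r) / 3) ^ 2) = c₂ * q := by
    linear_combination c₂ * (2 / 3) * hr2
  linarith

/-- Here `(C, D, D)` would have a negative entry, so the smallest entry is pushed to `0` instead;
the other two are the roots of `t² - e t + p`. -/
lemma exists_triple_entropy_lt_of_lt {x y z e q : ℝ} (hx : 0 < x) (hxy : x ≤ y) (hyz : y < z)
    (he : e = x + y + z) (hq : q = x ^ 2 + y ^ 2 + z ^ 2) (hcase : e ^ 2 < 2 * q) :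
    ∃ x' y' z' : ℝ, 0 ≤ x' ∧ 0 ≤ y' ∧ 0 ≤ z' ∧ x' + y' + z' = e ∧
      x' ^ 2 + y' ^ 2 + z' ^ 2 = q ∧
      negMulLog (x ^ 2) + negMulLog (y ^ 2) + negMulLog (z ^ 2)
        < negMulLog (x' ^ 2) + negMulLog (y' ^ 2) + negMulLog (z' ^ 2) := by
  set p := x * y + y * z + x * z with hp
  have hpe : e ^ 2 = q + 2 * p := by rw [he, hq, hp]; ring
  have hppos : 0 < p := by
    have : 0 < y := by linarith
    have : 0 < z := by linarith
    positivity
  set r := √(e ^ 2 - 4 * p) with hr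
  have hr2 : r ^ 2 = e ^ 2 - 4 * p := sq_sqrt (by linarith)
  have hr0 : 0 < r := sqrt_pos.2 (by linarith)
  have hepos : 0 < e := by linarith
  have hre : r < e := lt_of_pow_lt_pow_left₀ 2 hepos.le (by linarith)
  obtain ⟨c₁, c₂, ey, ez, hlt⟩ := exists_secant_quadratic (y := (e - r) / 2) (z := (e + r) / 2)
    (by linarith) (by linarith)
  -- The two monic cubics share their first two elementary symmetric functions, so they differ by
  -- the constant `x y z > 0`. This makes the nodal product positive at `x`, `y` and `z`.
  have hcub : ∀ t, t * (t - (e - r) / 2) * (t - (e + r) / 2)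
      = (t - x) * (t - y) * (t - z) + x * y * z := fun t => by
    have : t * (t - (e - r) / 2) * (t - (e + r) / 2) = t * (t ^ 2 - e * t + (e ^ 2 - r ^ 2) / 4) := by
      ring
    rw [this, hr2, he, hp]; ring
  have hxyz : 0 < x * y * z := by
    have : 0 < y := by linarith
    have : 0 < z := by linarith
    positivity
  have h1 := hlt x hx (by rw [hcub]; simpa using hxyz)
  have h2 := hlt y (by linarith) (by rw [hcub]; simpa using hxyz)
  have h3 := hlt z (by linarith) (by rw [hcub]; simpa using hxyz)
  refine ⟨0, (e - r) / 2, (e + r) / 2, le_rfl, by linarith, by linarith, by ring,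
    by linear_combination (1 / 2) * hr2 + hpe, ?_⟩
  rw [ey, ez]
  have hsum : c₁ * x + c₁ * y + c₁ * z = c₁ * e := by rw [he]; ring
  have hsq : c₂ * x ^ 2 + c₂ * y ^ 2 + c₂ * z ^ 2 = c₂ * q := by rw [hq]; ring
  have htot : c₂ * ((e - r) / 2) ^ 2 + c₂ * ((e + r) / 2) ^ 2 = c₂ * q := by
    linear_combination c₂ * ((1 / 2) * hr2 + hpe)
  simp only [ne_eq, OfNat.ofNat_ne_zero, not_false_eq_true, zero_pow, negMulLog_zero]
  linarith

/-- A nonnegative triple `x ≤ y < z` with `0 < x` can be replaced by one of larger entropy with the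
same sum and sum of squares. -/
lemma exists_triple_entropy_lt {x y z : ℝ} (hx : 0 < x) (hxy : x ≤ y) (hyz : y < z) :
    ∃ x' y' z' : ℝ, 0 ≤ x' ∧ 0 ≤ y' ∧ 0 ≤ z' ∧ x' + y' + z' = x + y + z ∧
      x' ^ 2 + y' ^ 2 + z' ^ 2 = x ^ 2 + y ^ 2 + z ^ 2 ∧
      negMulLog (x ^ 2) + negMulLog (y ^ 2) + negMulLog (z ^ 2)
        < negMulLog (x' ^ 2) + negMulLog (y' ^ 2) + negMulLog (z' ^ 2) := by
  rcases le_or_gt (2 * (x ^ 2 + y ^ 2 + z ^ 2)) ((x + y + z) ^ 2) with h | h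
  · exact exists_triple_entropy_lt_of_le hx hxy hyz rfl rfl h
  · exact exists_triple_entropy_lt_of_lt hx hxy hyz rfl rfl h

/-- The nonnegative vectors with a given sum and with sum of squares one. -/
def amplitudes (N : ℕ) (s : ℝ) : Set (Fin N → ℝ) :=
  {x | (∀ i, 0 ≤ x i) ∧ ∑ i, x i = s ∧ ∑ i, x i ^ 2 = 1}

lemma isCompact_amplitudes (N : ℕ) (s : ℝ) : IsCompact (amplitudes N s) := by
  refine (isCompact_univ_pi fun _ : Fin N => isCompact_Icc (a := (0 : ℝ)) (b := 1)).of_isClosed_subset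
    ?_ fun x hx i _ => ⟨hx.1 i, ?_⟩
  · simp only [amplitudes, Set.ofPred_and, Set.ofPred_forall]
    refine (isClosed_iInter fun i => isClosed_le (by fun_prop) (by fun_prop)).inter
      ((isClosed_eq (by fun_prop) (by fun_prop)).inter (isClosed_eq (by fun_prop) (by fun_prop)))
  · have := Finset.single_le_sum (f := fun j => x j ^ 2) (fun j _ => sq_nonneg (x j))
      (Finset.mem_univ i)
    rw [hx.2.2] at this
    exact (sq_le_one_iff₀ (hx.1 i)).1 this

lemma exists_isMaxOn_amplitudes {N : ℕ} {s : ℝ} (h : (amplitudes N s).Nonempty) :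
    ∃ x ∈ amplitudes N s, IsMaxOn (fun x => ∑ i, negMulLog (x i ^ 2)) (amplitudes N s) x :=
  (isCompact_amplitudes N s).exists_isMaxOn h (by fun_prop)

lemma not_lt_of_isMaxOn {N : ℕ} {s : ℝ} {x : Fin N → ℝ} (hx : x ∈ amplitudes N s)
    (hmax : IsMaxOn (fun x => ∑ i, negMulLog (x i ^ 2)) (amplitudes N s) x) {i j k : Fin N}
    (hij : i ≠ j) (hik : i ≠ k) (hi : 0 < x i) (hle : x i ≤ x j) : ¬ x j < x k := by
  intro hlt
  have hjk : j ≠ k := fun h => by rw [h] at hlt; exact hlt.false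
  obtain ⟨a, b, c, ha, hb, hc, hsum, hsq, hent⟩ := exists_triple_entropy_lt hi hle hlt
  let y : Fin N → ℝ := fun l => if l = i then a else if l = j then b else if l = k then c else x l
  have yi : y i = a := by simp [y]
  have yj : y j = b := by simp [y, hij.symm]
  have yk : y k = c := by simp [y, hik.symm, hjk.symm]
  have hy : ∀ g : ℝ → ℝ, ∑ l, g (y l) - ∑ l, g (x l)
      = (g a + g b + g c) - (g (x i) + g (x j) + g (x k)) := fun g => by
    rw [← Finset.sum_sub_distrib, ← Finset.sum_subset (Finset.subset_univ {i, j, k})]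
    · rw [Finset.sum_insert (by simp [hij, hik]), Finset.sum_insert (by simp [hjk]),
        Finset.sum_singleton, yi, yj, yk]
      ring
    · intro l _ hl
      simp only [Finset.mem_insert, Finset.mem_singleton, not_or] at hl
      simp [y, hl.1, hl.2.1, hl.2.2]
  have hmem : y ∈ amplitudes N s := by
    refine ⟨fun l => ?_, ?_, ?_⟩
    · simp only [y]; split_ifs
      exacts [ha, hb, hc, hx.1 l]
    · have := hy fun t => t
      linarith [hx.2.1]
    · have := hy fun t => t ^ 2
      linarith [hx.2.2]
  have h1 := hmax hmem
  have h2 := hy fun t => negMulLog (t ^ 2)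
  simp only [Set.mem_ofPred_eq] at h1
  linarith

/-- For `b ≥ 0`, `supportSize b` is the unique integer `m` with `m - 2 < b ≤ m - 1`; this form
serves in place of the case distinction. -/
lemma supportSize_eq {b : ℝ} {m : ℕ} (h1 : (m : ℝ) - 2 < b) (h2 : b ≤ (m : ℝ) - 1) (hb : 0 ≤ b) :
    supportSize b = m := by
  have hm : 1 ≤ m := by
    have : (1 : ℝ) ≤ m := by linarith
    exact_mod_cast this
  rw [supportSize]
  rcases h2.eq_or_lt with h | h
  · have hb' : b = ((m - 1 : ℕ) : ℝ) := by rw [h, Nat.cast_sub hm, Nat.cast_one]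
    rw [if_pos ⟨m - 1, hb'⟩, hb', Nat.floor_natCast]
    omega
  · obtain ⟨l, rfl⟩ : ∃ l, m = l + 2 := ⟨m - 2, by
      have : (1 : ℝ) < m := by linarith
      have : 1 < m := by exact_mod_cast this
      omega⟩
    push_cast at h1 h
    have hfl : ⌊b⌋₊ = l := (Nat.floor_eq_iff hb).2 ⟨by linarith, by linarith⟩
    rw [if_neg, hfl]
    rintro ⟨q, rfl⟩
    have e1 : l < q := by
      have : (l : ℝ) < q := by linarith
      exact_mod_cast this
    have e2 : q < l + 1 := by
      have : (q : ℝ) < l + 1 := by linarith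
      exact_mod_cast this
    omega

lemma supportSize_spec {b : ℝ} (hb : 0 ≤ b) :
    (supportSize b : ℝ) - 2 < b ∧ b ≤ (supportSize b : ℝ) - 1 := by
  have h1 := Nat.lt_floor_add_one b
  have h2 := Nat.floor_le hb
  rw [supportSize]
  split_ifs with h
  · obtain ⟨m, rfl⟩ := h
    rw [Nat.floor_natCast]
    push_cast
    constructor <;> linarith
  · have h3 : b ≠ (⌊b⌋₊ : ℝ) := fun e => h ⟨_, e⟩
    have h4 := lt_of_le_of_ne h2 h3.symm
    push_cast
    constructor <;> linarith

lemma beta_eq_one {b : ℝ} {k : ℕ} (hb : 0 ≤ b) (hbk : b ≤ (k : ℝ) - 1) (h : k = 1) :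
    beta b k = 1 := by
  have hd' : (k : ℝ) = 1 := by exact_mod_cast h
  have hb0 : b = 0 := by linarith
  rw [beta, hd', hb0]; norm_num

/-- The maximisers of the entropy for a given sum of amplitudes. -/
lemma exists_perm_of_isMaxOn {N : ℕ} {b : ℝ} (hb : 0 ≤ b) {x : Fin N → ℝ}
    (hx : x ∈ amplitudes N √(b + 1))
    (hmax : IsMaxOn (fun x => ∑ i, negMulLog (x i ^ 2)) (amplitudes N √(b + 1)) x) :
    ∃ σ : Equiv.Perm (Fin N), ∀ i,
      x (σ i) ^ 2 = profile N (supportSize b) (beta b (supportSize b)) i := by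
  set S := Finset.univ.filter fun i => x i ≠ 0 with hS
  have hmem : ∀ i, i ∈ S ↔ x i ≠ 0 := fun i => by simp [hS]
  have hpos : ∀ i ∈ S, 0 < x i := fun i hi => (hx.1 i).lt_of_ne' ((hmem i).1 hi)
  set s := √(b + 1) with hs
  have hs2 : s ^ 2 = b + 1 := sq_sqrt (by linarith)
  have hs0 : 0 ≤ s := sqrt_nonneg _
  have hSsum : ∑ i ∈ S, x i = s := by
    rw [← hx.2.1]; exact sum_filter_ne_zero (g := fun t => t) rfl
  have hSsq : ∑ i ∈ S, x i ^ 2 = 1 := by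
    rw [← hx.2.2]; exact sum_filter_ne_zero (g := fun t => t ^ 2) (by simp)
  have hne : S.Nonempty := by
    by_contra h
    rw [Finset.not_nonempty_iff_eq_empty.1 h] at hSsq
    simp at hSsq
  obtain ⟨i₀, hi₀, hmin⟩ := S.exists_min_image x hne
  -- With `x i₀` the smallest nonzero entry, the triple argument applied in both orders makes any
  -- two other nonzero entries equal. If there are none, `D` is arbitrary, as its weight `m - 1` is
  -- zero.
  obtain ⟨D, hD, hDle⟩ : ∃ D, (∀ j ∈ S, j ≠ i₀ → x j = D) ∧ x i₀ ≤ D := by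
    by_cases h : ∃ j ∈ S, j ≠ i₀
    · obtain ⟨j, hj, hji⟩ := h
      refine ⟨x j, fun k hk hki => le_antisymm ?_ ?_, hmin j hj⟩
      · exact not_lt.1 (not_lt_of_isMaxOn hx hmax hji.symm hki.symm (hpos _ hi₀) (hmin j hj))
      · exact not_lt.1 (not_lt_of_isMaxOn hx hmax hki.symm hji.symm (hpos _ hi₀) (hmin k hk))
    · push Not at h
      exact ⟨x i₀, fun j hj hji => absurd (h j hj) hji, le_rfl⟩
  set C := x i₀ with hC
  have hCpos : 0 < C := hpos _ hi₀
  obtain ⟨m, hm⟩ : ∃ m, S.card = m := ⟨_, rfl⟩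
  have hm1 : 1 ≤ m := hm ▸ Finset.card_pos.2 hne
  have hm1' : (1 : ℝ) ≤ m := by exact_mod_cast hm1
  have hsums : ∀ g : ℝ → ℝ, ∑ i ∈ S, g (x i) = g C + ((m : ℝ) - 1) * g D := fun g => by
    rw [← Finset.add_sum_erase S (fun i => g (x i)) hi₀, Finset.sum_congr rfl
      (fun j hj => by rw [hD j (Finset.mem_of_mem_erase hj) (Finset.ne_of_mem_erase hj)] :
        ∀ j ∈ S.erase i₀, g (x j) = g D), Finset.sum_const, Finset.card_erase_of_mem hi₀, hm,
      nsmul_eq_mul, Nat.cast_sub hm1, Nat.cast_one]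
  have e1 : C + ((m : ℝ) - 1) * D = s := by rw [← hSsum]; exact (hsums fun t => t).symm
  have e2 : C ^ 2 + ((m : ℝ) - 1) * D ^ 2 = 1 := (hsums fun t => t ^ 2).symm.trans hSsq
  -- The strict inequality rests on `0 < C ≤ D`: `s² - (m - 1) = C² + (m - 1) C (2D - C) > 0`.
  have hb1 : (m : ℝ) - 2 < b := by
    have h1 : s ^ 2 - (m - 1) = C ^ 2 + (m - 1) * (C * (D + (D - C))) := by
      rw [← e1]; linear_combination ((m : ℝ) - 1) * e2
    have h2 : 0 ≤ ((m : ℝ) - 1) * (C * (D + (D - C))) := by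
      refine mul_nonneg (by linarith) (mul_nonneg hCpos.le (by linarith))
    have := pow_pos hCpos 2
    linarith
  -- The radicand is a square, and `C ≤ D` fixes the sign of its root: this selects `β`, the
  -- solution with the minus sign.
  have hdiff : ((m : ℝ) - 1) * (m - 1 - b) = (((m : ℝ) - 1) * (D - C)) ^ 2 := by
    have : (m : ℝ) - 1 - b = m - s ^ 2 := by rw [hs2]; ring
    rw [this, ← e1]; linear_combination -(m : ℝ) * (m - 1) * e2
  have hb2 : b ≤ (m : ℝ) - 1 := by
    have h := sq_sum_le_card_mul_sum_sq (s := S) (f := x)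
    rw [hSsum, hSsq, hm] at h
    linarith
  have hsize : supportSize b = m := supportSize_eq hb1 hb2 hb
  have hbeta : beta b m = C ^ 2 := by
    rw [beta_eq_sq hb hb2, hdiff, sqrt_sq (mul_nonneg (by linarith) (by linarith)), ← hs, ← e1]
    congr 1
    have : (m : ℝ) ≠ 0 := by linarith
    field_simp
    ring
  rw [hsize]
  refine exists_perm_eq_profile (p := fun i => x i ^ 2) (by simpa using hm) (i₀ := i₀)
    hbeta.symm (pow_ne_zero 2 hCpos.ne') fun i hi1 hi2 => ?_
  have hiS : i ∈ S := (hmem i).2 fun h => hi1 (by simp [h])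
  have hmne : m ≠ 1 := fun h => hi2 (Finset.card_le_one.1 (by rw [hm, h]) _ hiS _ hi₀)
  have : (m : ℝ) - 1 ≠ 0 := sub_ne_zero.2 (by exact_mod_cast hmne)
  change x i ^ 2 = _
  rw [hD i hiS hi2, hbeta]
  field_simp
  linarith

/-- The greatest entropy for a given sum of amplitudes. -/
theorem sum_negMulLog_le_entropyBound {N : ℕ} {x : Fin N → ℝ} {b : ℝ} (hb : 0 ≤ b)
    (hbN : supportSize b ≤ N) (hx : x ∈ amplitudes N √(b + 1)) :
    ∑ i, negMulLog (x i ^ 2) ≤ entropyBound (beta b (supportSize b)) (supportSize b) * log 2 ∧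
    (∑ i, negMulLog (x i ^ 2) = entropyBound (beta b (supportSize b)) (supportSize b) * log 2 →
      ∃ σ : Equiv.Perm (Fin N), ∀ i,
        x (σ i) ^ 2 = profile N (supportSize b) (beta b (supportSize b)) i) := by
  have hspec := supportSize_spec hb
  have hk : 1 ≤ supportSize b := by
    have : (1 : ℝ) ≤ supportSize b := by linarith
    exact_mod_cast this
  obtain ⟨y, hy, hmax⟩ := exists_isMaxOn_amplitudes ⟨x, hx⟩
  obtain ⟨σ, hσ⟩ := exists_perm_of_isMaxOn hb hy hmax
  have hval := sum_negMulLog_eq_of_perm_profile hk hbN (beta_eq_one hb hspec.2)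
    (p := fun i => y i ^ 2) hσ
  -- A vector attaining the bound is itself a maximiser, so its shape is already known.
  refine ⟨hval ▸ hmax hx, fun h => exists_perm_of_isMaxOn hb hx fun z hz => ?_⟩
  have h1 := hmax hz
  simp only [Set.mem_ofPred_eq] at h1 ⊢
  linarith

/-! ### Bounds for pure states and their attainment. -/

section States

variable {N : ℕ} {ψ : EuclideanSpace ℂ (Fin N)}

lemma relEntropyCoherence_eq_iff (h : ‖ψ‖ = 1) {B : ℝ} :
    relEntropyCoherence (pureState ψ) = (B : EReal) ↔
      ∑ i, negMulLog (‖ψ i‖ ^ 2) = B * log 2 := by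
  rw [relEntropyCoherence_pureState h, EReal.coe_eq_coe_iff,
    div_eq_iff (log_pos one_lt_two).ne']

lemma norm_mem_amplitudes (h : ‖ψ‖ = 1) :
    0 ≤ l1Coherence (pureState ψ) ∧
      (fun i => ‖ψ i‖) ∈ amplitudes N √(l1Coherence (pureState ψ) + 1) := by
  have hs : 0 ≤ ∑ i, ‖ψ i‖ := Finset.sum_nonneg fun i _ => norm_nonneg _
  have hle : ∀ i, ‖ψ i‖ ≤ ∑ j, ‖ψ j‖ := fun i =>
    Finset.single_le_sum (f := fun j => ‖ψ j‖) (fun j _ => norm_nonneg _) (Finset.mem_univ i)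
  have h1 := Finset.sum_le_sum fun i (_ : i ∈ Finset.univ) =>
    mul_le_mul_of_nonneg_left (hle i) (norm_nonneg (ψ i))
  rw [← Finset.sum_mul, ← sq] at h1
  simp only [← sq] at h1
  rw [sum_norm_sq_eq_one h] at h1
  rw [l1Coherence_pureState h, sub_add_cancel, sqrt_sq hs]
  exact ⟨sub_nonneg.2 h1, fun i => norm_nonneg _, rfl, sum_norm_sq_eq_one h⟩

lemma l1Coherence_add_one_le (h : ‖ψ‖ = 1) :
    l1Coherence (pureState ψ) + 1 ≤ diagRank (pureState ψ) := by
  have h1 := sq_sum_le_card_mul_sum_sq (s := Finset.univ.filter fun i => ‖ψ i‖ ≠ 0)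
    (f := fun i => ‖ψ i‖)
  rw [sum_filter_ne_zero (g := fun t => t) rfl,
    sum_filter_ne_zero (g := fun t => t ^ 2) (by simp), sum_norm_sq_eq_one h, mul_one,
    ← diagRank_pureState] at h1
  rwa [l1Coherence_pureState h, sub_add_cancel]

lemma diagRank_le (ψ : EuclideanSpace ℂ (Fin N)) : diagRank (pureState ψ) ≤ N := by
  rw [diagRank_pureState]
  simpa using Finset.card_le_univ (Finset.univ.filter fun i => ‖ψ i‖ ≠ 0)

lemma supportSize_le {b : ℝ} (hb : 0 ≤ b) (hbN : b ≤ (N : ℝ) - 1) : supportSize b ≤ N := by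
  have h : (supportSize b : ℝ) < (N + 1 : ℕ) := by
    push_cast
    linarith [(supportSize_spec hb).1]
  exact Nat.lt_succ_iff.1 (by exact_mod_cast h)

lemma alpha_eq_one {b : ℝ} {k : ℕ} (hb : 0 ≤ b) (hbk : b ≤ (k : ℝ) - 1) (h : k = 1) :
    alpha b k = 1 := by
  have hd' : (k : ℝ) = 1 := by exact_mod_cast h
  have hb0 : b = 0 := by linarith
  rw [alpha, hd', hb0]; norm_num

/-- The lower bound on the coherence of a pure state, with its equality case. -/
theorem alpha_bound (h : ‖ψ‖ = 1) :
    (entropyBound (alpha (l1Coherence (pureState ψ)) (diagRank (pureState ψ)))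
        (diagRank (pureState ψ)) : EReal) ≤ relEntropyCoherence (pureState ψ) ∧
    (relEntropyCoherence (pureState ψ)
        = (entropyBound (alpha (l1Coherence (pureState ψ)) (diagRank (pureState ψ)))
          (diagRank (pureState ψ)) : EReal) ↔
      HasDiagonal (pureState ψ)
        (profile N (diagRank (pureState ψ))
          (alpha (l1Coherence (pureState ψ)) (diagRank (pureState ψ))))) := by
  obtain ⟨hb, hx⟩ := norm_mem_amplitudes h
  have hbd := le_sub_iff_add_le.2 (l1Coherence_add_one_le h)
  have hd := diagRank_pureState ψ
  have hdN := diagRank_le ψ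
  have key := entropyBound_le_sum_negMulLog hx.1 hb hbd hx.2.1 hx.2.2 hd.symm
  refine ⟨?_, ?_⟩
  · rw [relEntropyCoherence_pureState h, EReal.coe_le_coe_iff, le_div_iff₀ (log_pos one_lt_two)]
    exact key.1
  · rw [relEntropyCoherence_eq_iff h, hasDiagonal_pureState_iff]
    refine ⟨key.2, fun ⟨σ, hσ⟩ => sum_negMulLog_eq_of_perm_profile ?_ hdN ?_ hσ⟩
    · have : (1 : ℝ) ≤ diagRank (pureState ψ) := by linarith
      exact_mod_cast this
    · exact alpha_eq_one hb hbd

/-- The upper bound on the coherence of a pure state, with its equality case. -/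
theorem beta_bound (h : ‖ψ‖ = 1) {b : ℝ} (hψ : l1Coherence (pureState ψ) = b) :
    relEntropyCoherence (pureState ψ)
      ≤ (entropyBound (beta b (supportSize b)) (supportSize b) : EReal) ∧
    (relEntropyCoherence (pureState ψ)
        = (entropyBound (beta b (supportSize b)) (supportSize b) : EReal) ↔
      HasDiagonal (pureState ψ) (profile N (supportSize b) (beta b (supportSize b)))) := by
  obtain ⟨hb, hx⟩ := norm_mem_amplitudes h
  have hbd := l1Coherence_add_one_le h
  have hdN : (diagRank (pureState ψ) : ℝ) ≤ N := by exact_mod_cast diagRank_le ψ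
  rw [hψ] at hb hx hbd
  have hnN := supportSize_le (N := N) hb (by linarith)
  have hspec := supportSize_spec hb
  have key := sum_negMulLog_le_entropyBound hb hnN hx
  refine ⟨?_, ?_⟩
  · rw [relEntropyCoherence_pureState h, EReal.coe_le_coe_iff, div_le_iff₀ (log_pos one_lt_two)]
    exact key.1
  · rw [relEntropyCoherence_eq_iff h, hasDiagonal_pureState_iff]
    refine ⟨key.2, fun ⟨σ, hσ⟩ =>
      sum_negMulLog_eq_of_perm_profile ?_ hnN (beta_eq_one hb hspec.2) hσ⟩
    have : (1 : ℝ) ≤ supportSize b := by linarith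
    exact_mod_cast this

/-- A pure state with given coherence and with diagonal the profile of a solution `(s + w) / k` of
the equation for the distinguished amplitude, `w` being either square root. -/
lemma exists_state_of_root {b w : ℝ} {k : ℕ} (hb : 0 ≤ b) (hbk : b ≤ (k : ℝ) - 1) (hkN : k ≤ N)
    (hw : w ^ 2 = ((k : ℝ) - 1) * ((k : ℝ) - 1 - b)) (hw0 : 0 ≤ √(b + 1) + w)
    (hw1 : w ≤ ((k : ℝ) - 1) * √(b + 1)) :
    ∃ ψ : EuclideanSpace ℂ (Fin N), ‖ψ‖ = 1 ∧ l1Coherence (pureState ψ) = b ∧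
      ∀ i, ‖ψ i‖ ^ 2 = profile N k (((√(b + 1) + w) / k) ^ 2) i := by
  have hk : (1 : ℝ) ≤ k := by linarith
  have hs := sq_sqrt (by linarith : 0 ≤ b + 1)
  obtain ⟨ψ, h1, h2, h3⟩ := exists_state_of_profile (N := N) (k := k) (s := √(b + 1))
    (A := (√(b + 1) + w) / k) (by exact_mod_cast hk) hkN (div_nonneg hw0 (by linarith))
    (by rw [div_le_iff₀ (by linarith)]; linarith)
    (sq_sub_eq_of_sq_eq (by linarith) (by rw [hw, hs]; ring)) (fun h => by
      have hk' : (k : ℝ) = 1 := by exact_mod_cast h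
      have hb0 : b = 0 := by linarith
      have hw' : w = 0 := by
        rw [hk', sub_self, zero_mul] at hw
        exact pow_eq_zero_iff two_ne_zero |>.1 hw
      rw [hk', hb0, hw']; simp)
  refine ⟨ψ, h1, ?_, h3⟩
  rw [l1Coherence_pureState h1, h2, hs]; ring

theorem exists_state_alpha {b : ℝ} {d : ℕ} (hb : 0 ≤ b) (hbd : b ≤ (d : ℝ) - 1)
    (hb0 : b = 0 → d = 1) (hdN : d ≤ N) :
    ∃ ψ : EuclideanSpace ℂ (Fin N), ‖ψ‖ = 1 ∧ l1Coherence (pureState ψ) = b ∧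
      diagRank (pureState ψ) = d ∧
      relEntropyCoherence (pureState ψ) = (entropyBound (alpha b d) d : EReal) := by
  have hs : 0 < √(b + 1) := sqrt_pos.2 (by linarith)
  have hw := sq_sqrt (mul_nonneg (by linarith : (0 : ℝ) ≤ (d : ℝ) - 1)
    (by linarith : (0 : ℝ) ≤ (d : ℝ) - 1 - b))
  have hd1 : (1 : ℝ) ≤ d := by linarith
  have hd1' : 1 ≤ d := by exact_mod_cast hd1
  obtain ⟨ψ, h1, h2, h3⟩ := exists_state_of_root (N := N) hb hbd hdN hw
    (add_nonneg hs.le (sqrt_nonneg _)) (sqrt_le_mul_sqrt hb hbd)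
  rw [← alpha_eq_sq hb hbd] at h3
  refine ⟨ψ, h1, h2, ?_, ?_⟩
  · have hcard : (Finset.univ.filter fun i => ‖ψ i‖ ≠ 0)
        = Finset.univ.filter fun i => profile N d (alpha b d) i ≠ 0 := by
      ext i; simp [← h3]
    rw [diagRank_pureState, hcard]
    -- For `d ≠ 1` the rank is `d` only if `α ≠ 1`; `α = 1` would give `s = A = 1` and hence `b =
    -- 0`, which `hb0` allows only for `d = 1`.
    refine card_support_profile hd1' hdN ?_ fun hd h => ?_
    · rw [alpha_eq_sq hb hbd]; positivity
    · have hA := sq_sub_eq_of_sq_eq (s := √(b + 1)) (k := d) (by linarith)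
        (by rw [hw, sq_sqrt (by linarith : 0 ≤ b + 1)]; ring)
      rw [alpha_eq_sq hb hbd] at h
      rw [h, sub_self, mul_zero] at hA
      have hA' := sub_eq_zero.1 (pow_eq_zero_iff two_ne_zero |>.1 hA)
      rw [← hA', sq_sqrt (by linarith)] at h
      exact hd (hb0 (by linarith))
  · rw [relEntropyCoherence_eq_iff h1]
    exact sum_negMulLog_eq_of_perm_profile hd1' hdN (alpha_eq_one hb hbd) (σ := Equiv.refl _) h3

theorem exists_state_beta {b : ℝ} (hb : 0 ≤ b) (hbN : b ≤ (N : ℝ) - 1) :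
    ∃ ψ : EuclideanSpace ℂ (Fin N), ‖ψ‖ = 1 ∧ l1Coherence (pureState ψ) = b ∧
      relEntropyCoherence (pureState ψ)
        = (entropyBound (beta b (supportSize b)) (supportSize b) : EReal) := by
  obtain ⟨hn, hbn⟩ := supportSize_spec hb
  have hnN := supportSize_le hb hbN
  have hw0 := mul_nonneg (by linarith : (0 : ℝ) ≤ (supportSize b : ℝ) - 1)
    (by linarith : (0 : ℝ) ≤ (supportSize b : ℝ) - 1 - b)
  -- With `n = supportSize b`, `(b + 1) - (n - 1)(n - 1 - b) = n (b - (n - 2))`, so `n - 2 < b`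
  -- keeps the amplitude `(s - w) / n` nonnegative.
  have hle : √(((supportSize b : ℝ) - 1) * ((supportSize b : ℝ) - 1 - b)) ≤ √(b + 1) :=
    sqrt_le_sqrt (by nlinarith)
  obtain ⟨ψ, h1, h2, h3⟩ := exists_state_of_root (N := N) hb hbn hnN
    (w := -√(((supportSize b : ℝ) - 1) * ((supportSize b : ℝ) - 1 - b)))
    (by rw [neg_sq, sq_sqrt hw0]) (by linarith)
    ((neg_nonpos.2 (sqrt_nonneg _)).trans (mul_nonneg (by linarith) (sqrt_nonneg _)))
  rw [← sub_eq_add_neg, ← beta_eq_sq hb hbn] at h3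
  refine ⟨ψ, h1, h2, (relEntropyCoherence_eq_iff h1).2 ?_⟩
  refine sum_negMulLog_eq_of_perm_profile ?_ hnN (beta_eq_one hb hbn) (σ := Equiv.refl _) h3
  have : (1 : ℝ) ≤ supportSize b := by linarith
  exact_mod_cast this

end States

end Coherence
end

theorem theorem1 (N : ℕ) :
    -- the two bounds, each with the diagonals for which it is an equality
    (∀ (ψ : EuclideanSpace ℂ (Fin N)) (b : ℝ) (d n : ℕ), ‖ψ‖ = 1 →
      Coherence.l1Coherence (Coherence.pureState ψ) = b →
      d = Coherence.diagRank (Coherence.pureState ψ) →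
      n = Coherence.supportSize b →
      (Coherence.entropyBound (Coherence.alpha b d) d : EReal)
          ≤ Coherence.relEntropyCoherence (Coherence.pureState ψ) ∧
      Coherence.relEntropyCoherence (Coherence.pureState ψ)
          ≤ (Coherence.entropyBound (Coherence.beta b n) n : EReal) ∧
      (Coherence.relEntropyCoherence (Coherence.pureState ψ)
          = (Coherence.entropyBound (Coherence.alpha b d) d : EReal) ↔
        Coherence.HasDiagonal (Coherence.pureState ψ)
          (Coherence.profile N d (Coherence.alpha b d))) ∧
      (Coherence.relEntropyCoherence (Coherence.pureState ψ)
          = (Coherence.entropyBound (Coherence.beta b n) n : EReal) ↔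
        Coherence.HasDiagonal (Coherence.pureState ψ)
          (Coherence.profile N n (Coherence.beta b n)))) ∧
    -- the lower bound is attained for all possible values of the coherence and the rank
    (∀ (b : ℝ) (d : ℕ), 0 ≤ b → b ≤ (d : ℝ) - 1 → (b = 0 → d = 1) → d ≤ N →
      ∃ ψ : EuclideanSpace ℂ (Fin N), ‖ψ‖ = 1 ∧
        Coherence.l1Coherence (Coherence.pureState ψ) = b ∧
        Coherence.diagRank (Coherence.pureState ψ) = d ∧
        Coherence.relEntropyCoherence (Coherence.pureState ψ)
          = (Coherence.entropyBound (Coherence.alpha b d) d : EReal)) ∧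
    -- the upper bound is attained for all possible values of the coherence
    (∀ b : ℝ, 0 ≤ b → b ≤ (N : ℝ) - 1 →
      ∃ ψ : EuclideanSpace ℂ (Fin N), ‖ψ‖ = 1 ∧
        Coherence.l1Coherence (Coherence.pureState ψ) = b ∧
        Coherence.relEntropyCoherence (Coherence.pureState ψ)
          = (Coherence.entropyBound (Coherence.beta b (Coherence.supportSize b))
              (Coherence.supportSize b) : EReal)) := by
  refine ⟨?_, fun b d hb hbd hb0 hdN => Coherence.exists_state_alpha hb hbd hb0 hdN,
    fun b hb hbN => Coherence.exists_state_beta hb hbN⟩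
  rintro ψ b d n h rfl rfl rfl
  have hα := Coherence.alpha_bound h
  have hβ := Coherence.beta_bound h rfl
  exact ⟨hα.1, hβ.1, hα.2, hβ.2⟩
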